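/- Let $r,s\ge 0$ be integers, $n=r+s$, let $M$ be an $r\times s$ integer matrix, and put $D=(I_r\mid M)$ and $\widehat D=(-M^T\mid I_s)$. Let $\mathcal S(D)=\mathbb Z^n/(\operatorname{im}_{\mathbb Z}(D^T)\oplus\ker_{\mathbb Z}(D))$ be the sandpile group of $D$. Let $\mathcal B(D)$ be the set of bases of $D$, that is, of the $r$-element subsets $B\subseteq\{1,\dots,n\}$ for which the $r\times r$ submatrix of $D$ with columns indexed by $B$ has nonzero determinant, and let $m(B)$ be the absolute value of this determinant. The fundamental parallelepiped of a matrix with columns $x_1,\dots,x_k$ is $\{\sum_i a_ix_i : 0\le a_i\le 1\}$. For $B\in\mathcal B(D)$ let $P(B)=P_1(B)\times P_2(B)\subseteq\mathbb R^r\times\mathbb R^s=\mathbb R^n$, where $P_1(B)$ is the fundamental parallelepiped of the submatrix of $D$ formed by the columns with index in $B$, and $P_2(B)$ is that of the submatrix of $\widehat D$ formed by the columns with index not in $B$. Let $T(D)=\bigcup_{B\in\mathcal B(D)}P(B)$. Let $\mathfrak w\in\mathbb R^n$ be a shifting vector of $D$: for no basis $B$ and no facet $F$ of $P(B)$ does $\mathfrak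 w$ lie in the linear hyperplane parallel to $F$. A vector $z\in\mathbb Z^n$ is called a $\mathfrak w$-representative if $z+\epsilon\mathfrak w\in T(D)$ for all sufficiently small $\epsilon>0$, and it is called $\mathfrak w$-associated with $B\in\mathcal B(D)$ if $z+\epsilon\mathfrak w\in P(B)$ for all sufficiently small $\epsilon>0$. Then every class in $\mathcal S(D)$ contains exactly one $\mathfrak w$-representative, and every $\mathfrak w$-representative is $\mathfrak w$-associated with exactly one basis. Hence there is a unique well-defined map $f_{\mathfrak w}:\mathcal S(D)\to\mathcal B(D)$ that sends each class to the basis with which its $\mathfrak w$-representative is $\mathfrak w$-associated. For every $B\in\mathcal B(D)$, $$|f_{\mathfrak w}^{-1}(B)|=m(B)^2 .$$ -/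

import Mathlib

namespace SandpileMultijection

open Matrix

variable {r s : ℕ}

/-- The index set of the `n = r + s` columns: the first `r` columns, then the last `s = n - r`. -/
abbrev Col (r s : ℕ) : Type := Fin r ⊕ Fin s

/-- The standard representative matrix `D = (I_r | M)`. -/
def stdRep (M : Matrix (Fin r) (Fin s) ℤ) : Matrix (Fin r) (Col r s) ℤ :=
  Matrix.fromCols 1 M

/-- The dual matrix `(-Mᵀ | I_s)` of `D`. -/
def dualRep (M : Matrix (Fin r) (Fin s) ℤ) : Matrix (Fin s) (Col r s) ℤ :=
  Matrix.fromCols (-Mᵀ) 1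

/-- The sandpile lattice `im_ℤ(Dᵀ) ⊕ ker_ℤ(D)` in `ℤⁿ`. -/
def sandpileLattice (M : Matrix (Fin r) (Fin s) ℤ) : Submodule ℤ (Col r s → ℤ) :=
  LinearMap.range (stdRep M)ᵀ.mulVecLin ⊔ LinearMap.ker (stdRep M).mulVecLin

/-- The sandpile group `𝒮(D)`, the cokernel of the sandpile lattice. -/
abbrev SandpileGroup (M : Matrix (Fin r) (Fin s) ℤ) : Type :=
  (Col r s → ℤ) ⧸ sandpileLattice M

/-- The maximal minor of `D` on an `r`-element set `B` of columns. The columns are put in some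
order, which only affects the sign. -/
noncomputable def maximalMinor (D : Matrix (Fin r) (Col r s) ℤ) (B : Finset (Col r s))
    (h : B.card = r) : ℤ :=
  (D.submatrix id (fun i : Fin r => ((B.equivFinOfCardEq h).symm i : Col r s))).det

/-- The absolute value of the maximal minor can be computed with any ordering of the columns. -/
theorem natAbs_maximalMinor (D : Matrix (Fin r) (Col r s) ℤ) (B : Finset (Col r s))
    (h : B.card = r) (e : Fin r ≃ B) :
    (maximalMinor D B h).natAbs = (D.submatrix id (fun i : Fin r => (e i : Col r s))).det.natAbs := by
  have key : D.submatrix id (fun i : Fin r => (e i : Col r s)) =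
      (D.submatrix id (fun i : Fin r => ((B.equivFinOfCardEq h).symm i : Col r s))).submatrix id
        (e.trans (B.equivFinOfCardEq h)) := by
    ext i j
    simp
  rw [key, Matrix.det_permute', Int.natAbs_mul, maximalMinor]
  simp

/-- The set `ℬ(D)` of bases of `D`: the `r`-element sets of columns with nonzero maximal minor. -/
def Bases (M : Matrix (Fin r) (Fin s) ℤ) : Type :=
  {B : Finset (Col r s) // ∃ h : B.card = r, maximalMinor (stdRep M) B h ≠ 0}

/-- The multiplicity `m(B)`: the absolute value of the maximal minor of `D` on `B`. -/
noncomputable def multiplicity {M : Matrix (Fin r) (Fin s) ℤ} (B : Bases M) : ℕ :=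
  (maximalMinor (stdRep M) B.1 B.2.fst).natAbs

/-- The (closed) fundamental parallelepiped spanned by the columns of an integer matrix. -/
def fundamentalParallelepiped {ι κ : Type} [Fintype κ] (A : Matrix ι κ ℤ) : Set (ι → ℝ) :=
  {x | ∃ a : κ → ℝ, (∀ k, 0 ≤ a k ∧ a k ≤ 1) ∧ ∀ i, x i = ∑ k, a k * (A i k : ℝ)}

/-- `P₁(B)`: the fundamental parallelepiped of `D` restricted to the columns in `B`. -/
def P₁ {M : Matrix (Fin r) (Fin s) ℤ} (B : Bases M) : Set (Fin r → ℝ) :=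
  fundamentalParallelepiped ((stdRep M).submatrix id (fun k : {k // k ∈ B.1} => (k : Col r s)))

/-- `P₂(B)`: the fundamental parallelepiped of the dual matrix restricted to the columns
not in `B`. -/
def P₂ {M : Matrix (Fin r) (Fin s) ℤ} (B : Bases M) : Set (Fin s → ℝ) :=
  fundamentalParallelepiped ((dualRep M).submatrix id (fun k : {k // k ∉ B.1} => (k : Col r s)))

/-- `P(B) = P₁(B) × P₂(B)`, as a subset of `ℝⁿ`. -/
def P {M : Matrix (Fin r) (Fin s) ℤ} (B : Bases M) : Set (Col r s → ℝ) :=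
  {x | (fun i => x (Sum.inl i)) ∈ P₁ B ∧ (fun j => x (Sum.inr j)) ∈ P₂ B}

/-- The tile `T(D)`: the union of all the parallelepipeds `P(B)`. -/
def tile (M : Matrix (Fin r) (Fin s) ℤ) : Set (Col r s → ℝ) :=
  ⋃ B : Bases M, P B

/-- `F` is a facet of the polytope `Q`: a nonempty (exposed) face of codimension one in `Q`. -/
def IsFacet (Q F : Set (Col r s → ℝ)) : Prop :=
  F.Nonempty ∧ IsExposed ℝ Q F ∧
    Module.finrank ℝ (vectorSpan ℝ F) + 1 = Module.finrank ℝ (vectorSpan ℝ Q)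

/-- A shifting vector: a vector that is not in the span of a facet of `P(B)` for any basis `B`.
The span of a facet is the linear hyperplane parallel to it, that is, the set of linear
combinations of differences of its points. -/
def IsShiftingVector (M : Matrix (Fin r) (Fin s) ℤ) (w : Col r s → ℝ) : Prop :=
  ∀ B : Bases M, ∀ F : Set (Col r s → ℝ), IsFacet (P B) F → w ∉ vectorSpan ℝ F

/-- `z + ε w ∈ X` for all sufficiently small `ε > 0`. -/
def PointsInto (X : Set (Col r s → ℝ)) (w : Col r s → ℝ) (z : Col r s → ℤ) : Prop :=
  ∃ ε₀ : ℝ, 0 < ε₀ ∧ ∀ ε : ℝ, 0 < ε → ε < ε₀ → (fun i => (z i : ℝ) + ε * w i) ∈ X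

/-- `z ∈ ℤⁿ` is a `w`-representative of `𝒮(D)`. -/
def IsRepresentative (M : Matrix (Fin r) (Fin s) ℤ) (w : Col r s → ℝ) (z : Col r s → ℤ) : Prop :=
  PointsInto (tile M) w z

/-- `z ∈ ℤⁿ` is `w`-associated with the basis `B`. -/
def IsAssociated {M : Matrix (Fin r) (Fin s) ℤ} (w : Col r s → ℝ) (z : Col r s → ℤ)
    (B : Bases M) : Prop :=
  PointsInto (P B) w z

/-- The rule that defines `f_w`: the class of a `w`-representative `z` is sent to a basis with
which `z` is `w`-associated. -/
def FollowsRule {M : Matrix (Fin r) (Fin s) ℤ} (w : Col r s → ℝ)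
    (f : SandpileGroup M → Bases M) : Prop :=
  ∀ z : Col r s → ℤ, IsRepresentative M w z →
    IsAssociated w z (f (Submodule.Quotient.mk z))

/-- `f` is an `m`-multijection: every `t` has exactly `m t` preimages. -/
def IsMultijection {S T : Type} (m : T → ℕ) (f : S → T) : Prop :=
  ∀ t : T, (f ⁻¹' {t}).encard = m t

end SandpileMultijection

/-! The proof is a count. Pairs of a basis and a vector associated with it map to sandpile classes;
`bijective_class_of_associated` shows that this map is bijective, and every claim follows from that.
Injectivity is geometric: by `eq_of_interior_inter`, translates of the P(B) by the sandpile lattice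
have pairwise disjoint interiors. This comes from the orthogonality of the kernels of D and its
dual, together with a sign check in each coordinate. Surjectivity needs no covering argument,
because both sides have the same finite size. A half-open parallelepiped holds as many integer
points as the absolute value of its determinant (`natCard_halfOpen`). For P(B) this is m(B)², since
complementary minors of D and its dual agree up to sign (`det_edgeMatrix_of_card_eq`). The group has
order det(1 + MMᵀ), the determinant of D stacked on its dual, and expanding that by columns gives
the sum of all m(B)² (`det_eq_sum_det_edgeMatrix`). -/

namespace SandpileMultijection

open Matrix Filter Topology

/-! ### Index of a full-rank integer lattice -/

section Lattice

variable {ι : Type*} [Fintype ι] [DecidableEq ι]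

/-- The index of the lattice spanned by the columns of a nonsingular integer matrix. -/
theorem natCard_quotient_range_mulVecLin (A : Matrix ι ι ℤ) (h : A.det ≠ 0) :
    Nat.card ((ι → ℤ) ⧸ LinearMap.range A.mulVecLin) = A.det.natAbs := by
  have hinj : Function.Injective A.mulVecLin := by
    rw [← LinearMap.ker_eq_bot, LinearMap.ker_eq_bot']
    intro x hx
    exact Matrix.eq_zero_of_mulVec_eq_zero h hx
  have key := Submodule.natAbs_det_equiv (LinearMap.range A.mulVecLin)
    (LinearEquiv.ofInjective A.mulVecLin hinj)
  rw [← key, ← LinearMap.det_toLin' A]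
  rfl

/-- The real matrix underlying an integer matrix. -/
abbrev toReal {ι κ : Type*} (A : Matrix ι κ ℤ) : Matrix ι κ ℝ := A.map (Int.cast : ℤ → ℝ)

variable {A : Matrix ι ι ℤ}

theorem isUnit_det_toReal (h : A.det ≠ 0) : IsUnit (toReal A).det := by
  have : (toReal A).det = (A.det : ℝ) := (RingHom.map_det (Int.castRingHom ℝ) A).symm
  rw [this, isUnit_iff_ne_zero]
  exact_mod_cast h

theorem toReal_mulVec_intCast {ι κ : Type*} [Fintype κ] (A : Matrix ι κ ℤ) (q : κ → ℤ) :
    toReal A *ᵥ (fun k => (q k : ℝ)) = fun i => ((A *ᵥ q) i : ℝ) := by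
  ext i
  simp [Matrix.mulVec, dotProduct]

end Lattice

/-! ### Half-open parallelepipeds as fundamental domains -/

section HalfOpen

/-- The half-open unit interval that `x` lies in when `x + ε v ∈ [0, 1]` for small `ε > 0`. -/
def HalfOpen (v x : ℝ) : Prop :=
  if 0 < v then x ∈ Set.Ico (0 : ℝ) 1 else x ∈ Set.Ioc (0 : ℝ) 1

/-- Closedness puts `x` in [0, 1], and a single good `ε` excludes the wrong endpoint. Assuming only
"frequently" matters later: a point of the tile might switch parallelepipeds as `ε` shrinks. -/
theorem halfOpen_of_frequently {v x : ℝ} (hv : v ≠ 0)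
    (h : ∃ᶠ ε in 𝓝[>] (0 : ℝ), x + ε * v ∈ Set.Icc (0 : ℝ) 1) : HalfOpen v x := by
  have hx : x ∈ Set.Icc (0 : ℝ) 1 := by
    refine isClosed_Icc.mem_of_frequently_of_tendsto h ?_
    have : Tendsto (fun ε : ℝ => x + ε * v) (𝓝 0) (𝓝 (x + 0 * v)) := by
      apply Continuous.tendsto; fun_prop
    rw [zero_mul, add_zero] at this
    exact this.mono_left nhdsWithin_le_nhds
  obtain ⟨ε, ⟨h0, h1⟩, hε⟩ := (h.and_eventually self_mem_nhdsWithin).exists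
  unfold HalfOpen
  split_ifs with hv'
  · exact ⟨hx.1, by nlinarith⟩
  · have : v < 0 := lt_of_le_of_ne (not_lt.mp hv') hv
    exact ⟨by nlinarith, hx.2⟩

theorem HalfOpen.eventually_mem_Ioo {v x : ℝ} (hv : v ≠ 0) (h : HalfOpen v x) :
    ∀ᶠ ε in 𝓝[>] (0 : ℝ), x + ε * v ∈ Set.Ioo (0 : ℝ) 1 := by
  have ht : Tendsto (fun ε : ℝ => x + ε * v) (𝓝[>] 0) (𝓝 x) := by
    have : Tendsto (fun ε : ℝ => x + ε * v) (𝓝 0) (𝓝 (x + 0 * v)) := by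
      apply Continuous.tendsto; fun_prop
    rw [zero_mul, add_zero] at this
    exact this.mono_left nhdsWithin_le_nhds
  unfold HalfOpen at h
  split_ifs at h with hv'
  · filter_upwards [ht.eventually_lt_const h.2, self_mem_nhdsWithin] with ε h1 hε
    exact ⟨add_pos_of_nonneg_of_pos h.1 (mul_pos hε hv'), h1⟩
  · have hneg : v < 0 := lt_of_le_of_ne (not_lt.mp hv') hv
    filter_upwards [ht.eventually_const_lt h.1, self_mem_nhdsWithin] with ε h1 hε
    exact ⟨h1, by nlinarith [h.2, mul_neg_of_pos_of_neg hε hneg]⟩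

theorem existsUnique_halfOpen_sub (v x : ℝ) : ∃! m : ℤ, HalfOpen v (x - m) := by
  unfold HalfOpen
  split_ifs
  · simpa using existsUnique_sub_zsmul_mem_Ico (zero_lt_one (α := ℝ)) x 0
  · simpa using existsUnique_sub_zsmul_mem_Ioc (zero_lt_one (α := ℝ)) x 0

variable {ι : Type*} [Fintype ι] [DecidableEq ι] {A : Matrix ι ι ℤ}

/-- The integer points of the half-open parallelepiped spanned by the columns of `A` are a system
of representatives modulo the lattice spanned by these columns. -/
theorem natCard_halfOpen (h : A.det ≠ 0) (v : ι → ℝ) :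
    Nat.card {z : ι → ℤ // ∀ k, HalfOpen (v k) (((toReal A)⁻¹ *ᵥ fun i => (z i : ℝ)) k)} =
      A.det.natAbs := by
  rw [← natCard_quotient_range_mulVecLin A h]
  have hA := isUnit_det_toReal h
  have hsub (z q : ι → ℤ) (k : ι) :
      ((toReal A)⁻¹ *ᵥ fun i => ((z - A *ᵥ q) i : ℝ)) k =
        ((toReal A)⁻¹ *ᵥ fun i => (z i : ℝ)) k - q k := by
    have : (fun i => (((z - A *ᵥ q) i : ℤ) : ℝ)) =
        (fun i => (z i : ℝ)) - toReal A *ᵥ (fun k => (q k : ℝ)) := by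
      rw [toReal_mulVec_intCast]; ext i; simp
    rw [this, Matrix.mulVec_sub, Matrix.mulVec_mulVec, Matrix.nonsing_inv_mul _ hA,
      Matrix.one_mulVec, Pi.sub_apply]
  refine Nat.card_eq_of_bijective
    (fun z => (Submodule.Quotient.mk z.1 : (ι → ℤ) ⧸ LinearMap.range A.mulVecLin)) ⟨?_, ?_⟩
  · rintro ⟨z, hz⟩ ⟨z', hz'⟩ hzz
    obtain ⟨q, hq⟩ := (Submodule.Quotient.eq _).mp hzz
    rw [Matrix.mulVecLin_apply] at hq
    change A *ᵥ q = z - z' at hq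
    have hz'eq : z' = z - A *ᵥ q := by rw [hq]; abel
    have hq0 : q = 0 := by
      ext k
      have h1 := hz' k
      rw [hz'eq, hsub] at h1
      refine (existsUnique_halfOpen_sub (v k) _).unique h1 ?_
      simpa using hz k
    simp [hz'eq, hq0]
  · intro c
    obtain ⟨z, rfl⟩ := Submodule.Quotient.mk_surjective _ c
    -- Subtracting the right integer from each coordinate moves the point into the half-open box.
    choose q hq using fun k => (existsUnique_halfOpen_sub (v k)
      (((toReal A)⁻¹ *ᵥ fun i => (z i : ℝ)) k)).exists
    refine ⟨⟨z - A *ᵥ q, fun k => by rw [hsub]; exact hq k⟩, ?_⟩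
    refine (Submodule.Quotient.eq _).mpr ⟨-q, ?_⟩
    simp [Matrix.mulVec_neg]

end HalfOpen

/-! ### Determinant identities and the order of the sandpile group -/

section Determinants

variable {r s : ℕ}

/-- The matrix whose columns are the edge vectors of `P B`. -/
def edgeMatrix (M : Matrix (Fin r) (Fin s) ℤ) (B : Finset (Col r s)) :
    Matrix (Col r s) (Col r s) ℤ :=
  Matrix.fromRows (Matrix.of fun i k => if k ∈ B then stdRep M i k else 0)
    (Matrix.of fun j k => if k ∈ B then 0 else dualRep M j k)

theorem stdRep_mul_dualRep_transpose (M : Matrix (Fin r) (Fin s) ℤ) :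
    stdRep M * (dualRep M)ᵀ = 0 := by
  simp [stdRep, dualRep, Matrix.transpose_fromCols, Matrix.fromCols_mul_fromRows]

theorem det_fromRows_stdRep_dualRep (M : Matrix (Fin r) (Fin s) ℤ) :
    (Matrix.fromRows (stdRep M) (dualRep M)).det = (1 + M * Mᵀ).det := by
  rw [stdRep, dualRep, Matrix.fromRows_fromCols_eq_fromBlocks, Matrix.det_fromBlocks_one₂₂]
  simp

theorem det_one_add_mul_transpose_pos (M : Matrix (Fin r) (Fin s) ℤ) :
    0 < (1 + M * Mᵀ).det := by
  have h : (toReal (1 + M * Mᵀ)).PosDef := by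
    have : toReal (1 + M * Mᵀ) = 1 + toReal M * (toReal M)ᴴ := by
      ext i j
      simp [Matrix.mul_apply, Matrix.one_apply]
    rw [this]
    exact Matrix.PosDef.one.add_posSemidef (Matrix.posSemidef_self_mul_conjTranspose _)
  have h2 := h.det_pos
  have : (toReal (1 + M * Mᵀ)).det = ((1 + M * Mᵀ).det : ℝ) :=
    (RingHom.map_det (Int.castRingHom ℝ) _).symm
  rw [this] at h2
  exact_mod_cast h2

/-- Each column of the stacked matrix is its upper part plus its lower part. Multilinearity then
gives one term per set `B` of columns that keep the upper part. -/
theorem det_eq_sum_det_edgeMatrix (M : Matrix (Fin r) (Fin s) ℤ) :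
    (1 + M * Mᵀ).det = ∑ B : Finset (Col r s), (edgeMatrix M B).det := by
  rw [← det_fromRows_stdRep_dualRep, ← Matrix.det_transpose]
  have h := (Matrix.detRowAlternating (R := ℤ) (n := Col r s)).toMultilinearMap.map_add_univ
    (fun k => Sum.elim (fun i => stdRep M i k) 0) (fun k => Sum.elim 0 (fun j => dualRep M j k))
  have h1 : (Matrix.fromRows (stdRep M) (dualRep M))ᵀ =
      (fun k => Sum.elim (fun i => stdRep M i k) 0 : Col r s → Col r s → ℤ) +
        (fun k => Sum.elim 0 (fun j => dualRep M j k) : Col r s → Col r s → ℤ) := by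
    ext k i
    cases i <;> simp
  rw [h1]
  refine h.trans (Finset.sum_congr rfl fun B _ => ?_)
  rw [← Matrix.det_transpose (edgeMatrix M B)]
  change Matrix.det _ = _
  congr 1
  ext k i
  by_cases hk : k ∈ B <;> cases i <;> simp [edgeMatrix, hk]

theorem det_edgeMatrix_of_card_ne (M : Matrix (Fin r) (Fin s) ℤ) (B : Finset (Col r s))
    (hB : B.card ≠ r) : (edgeMatrix M B).det = 0 := by
  rw [Matrix.det_apply]
  refine Finset.sum_eq_zero fun σ _ => ?_
  -- A nonzero Leibniz term would have to match `B` with the `r` upper rows.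
  suffices ∃ k, edgeMatrix M B (σ k) k = 0 by
    obtain ⟨k, hk⟩ := this
    have : ∏ i, edgeMatrix M B (σ i) i = 0 := Finset.prod_eq_zero (Finset.mem_univ k) hk
    exact (congrArg _ this).trans (smul_zero _)
  by_contra! hσ
  apply hB
  have hmem (k : Col r s) : k ∈ B ↔ (σ k).isLeft := by
    have := hσ k
    by_cases hk : k ∈ B <;> cases h : σ k <;> simp_all [edgeMatrix]
  have : B = (Finset.univ.map Function.Embedding.inl).map σ.symm.toEmbedding := by
    ext k
    rw [hmem]
    cases h : σ k <;> simp [h]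
  rw [this]
  simp

/-- After reordering columns by `e`, the edge matrix is block diagonal with blocks `A` and `G`.
Orthogonality of the rows of D and its dual forces det G = sign(e) det A, as in Jacobi's
complementary minor theorem. This sign cancels the one from the reordering, so the terms of the
expansion are true squares. -/
theorem det_edgeMatrix_of_card_eq (M : Matrix (Fin r) (Fin s) ℤ) (B : Finset (Col r s))
    (hB : B.card = r) : (edgeMatrix M B).det = maximalMinor (stdRep M) B hB ^ 2 := by
  have hB' : Fintype.card {k // k ∉ B} = s := by
    rw [Fintype.card_subtype_compl, Fintype.card_coe, hB]
    simp
  let e₁ : Fin r ≃ {k // k ∈ B} := (B.equivFinOfCardEq hB).symm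
  let e₂ : Fin s ≃ {k // k ∉ B} := (Fintype.equivFinOfCardEq hB').symm
  let e : Equiv.Perm (Col r s) := (Equiv.sumCongr e₁ e₂).trans (Equiv.sumCompl (· ∈ B))
  set A := (stdRep M).submatrix id (fun i => (e₁ i : Col r s)) with hA
  set C := (stdRep M).submatrix id (fun i => (e₂ i : Col r s)) with hC
  set F := (dualRep M).submatrix id (fun i => (e₁ i : Col r s)) with hF
  set G := (dualRep M).submatrix id (fun i => (e₂ i : Col r s)) with hG
  have hD : (stdRep M).submatrix id e = Matrix.fromCols A C := by
    ext i k; cases k <;> simp [e, A, C]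
  have hD' : (dualRep M).submatrix id e = Matrix.fromCols F G := by
    ext i k; cases k <;> simp [e, F, G]
  have hN : (edgeMatrix M B).submatrix id e = Matrix.fromBlocks A 0 0 G := by
    ext i k
    rcases k with k | k
    · have := (e₁ k).2
      cases i <;> simp [e, A, edgeMatrix]
    · have := (e₂ k).2
      cases i <;> simp [e, G, edgeMatrix, this]
  have hK : (Matrix.fromRows (stdRep M) (dualRep M)).submatrix id e = Matrix.fromBlocks A C F G := by
    rw [← Matrix.fromRows_fromCols_eq_fromBlocks, ← hD, ← hD']
    ext i k
    cases i <;> simp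
  have hDD : (stdRep M).submatrix id e * ((stdRep M).submatrix id e)ᵀ = 1 + M * Mᵀ := by
    rw [Matrix.transpose_submatrix, Matrix.submatrix_mul_equiv, Matrix.submatrix_id_id, stdRep,
      Matrix.transpose_fromCols, Matrix.fromCols_mul_fromRows]
    simp
  have hDD' : (stdRep M).submatrix id e * ((dualRep M).submatrix id e)ᵀ = 0 := by
    rw [Matrix.transpose_submatrix, Matrix.submatrix_mul_equiv, stdRep_mul_dualRep_transpose]
    simp
  rw [hD, Matrix.transpose_fromCols, Matrix.fromCols_mul_fromRows] at hDD
  rw [hD, hD', Matrix.transpose_fromCols, Matrix.fromCols_mul_fromRows] at hDD'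
  -- Taking determinants here compares det A with det G, because the second factor has determinant ±
  -- det(1 + MMᵀ), which is nonzero.
  have hprod : Matrix.fromBlocks A C 0 1 * (Matrix.fromBlocks A C F G)ᵀ =
      Matrix.fromBlocks (1 + M * Mᵀ) 0 Cᵀ Gᵀ := by
    rw [Matrix.fromBlocks_transpose, Matrix.fromBlocks_multiply, hDD, hDD']
    simp
  have hdet := congrArg Matrix.det hprod
  rw [Matrix.det_mul, Matrix.det_transpose, Matrix.det_fromBlocks_zero₂₁,
    Matrix.det_fromBlocks_zero₁₂, ← hK, Matrix.det_permute', det_fromRows_stdRep_dualRep,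
    Matrix.det_one, Matrix.det_transpose, mul_one, Int.cast_id] at hdet
  have hN' := congrArg Matrix.det hN
  rw [Matrix.det_permute', Matrix.det_fromBlocks_zero₂₁, Int.cast_id] at hN'
  have hpos := (det_one_add_mul_transpose_pos M).ne'
  have hG : ((Equiv.Perm.sign e : ℤˣ) : ℤ) * A.det = G.det := by
    apply mul_left_cancel₀ hpos
    rw [← hdet]; ring
  have hs : ((Equiv.Perm.sign e : ℤˣ) : ℤ) * ((Equiv.Perm.sign e : ℤˣ) : ℤ) = 1 := by
    rw [← Units.val_mul, Int.units_mul_self, Units.val_one]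
  change _ = A.det ^ 2
  calc (edgeMatrix M B).det
      = ((Equiv.Perm.sign e : ℤˣ) : ℤ) *
          (((Equiv.Perm.sign e : ℤˣ) : ℤ) * (edgeMatrix M B).det) := by
        rw [← mul_assoc, hs, one_mul]
    _ = (((Equiv.Perm.sign e : ℤˣ) : ℤ) * ((Equiv.Perm.sign e : ℤˣ) : ℤ)) * A.det ^ 2 := by
        rw [hN', ← hG]; ring
    _ = A.det ^ 2 := by rw [hs, one_mul]

noncomputable instance (M : Matrix (Fin r) (Fin s) ℤ) : Fintype (Bases M) :=
  haveI : Finite (Bases M) := inferInstanceAs (Finite {B : Finset (Col r s) //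
    ∃ h : B.card = r, maximalMinor (stdRep M) B h ≠ 0})
  Fintype.ofFinite _

theorem det_edgeMatrix_basis {M : Matrix (Fin r) (Fin s) ℤ} (B : Bases M) :
    (edgeMatrix M B.1).det = (multiplicity B : ℤ) ^ 2 := by
  rw [det_edgeMatrix_of_card_eq M B.1 B.2.fst, multiplicity, Int.natCast_natAbs, sq_abs]

theorem det_edgeMatrix_basis_ne_zero {M : Matrix (Fin r) (Fin s) ℤ} (B : Bases M) :
    (edgeMatrix M B.1).det ≠ 0 := by
  rw [det_edgeMatrix_of_card_eq M B.1 B.2.fst]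
  exact pow_ne_zero 2 B.2.snd

theorem det_eq_sum_multiplicity_sq (M : Matrix (Fin r) (Fin s) ℤ) :
    (1 + M * Mᵀ).det = ((∑ B : Bases M, multiplicity B ^ 2 : ℕ) : ℤ) := by
  classical
  rw [det_eq_sum_det_edgeMatrix]
  push_cast
  simp_rw [← det_edgeMatrix_basis]
  symm
  -- Sets that are not bases contribute zero: either the size is wrong or the minor vanishes.
  refine Finset.sum_of_injOn (fun B : Bases M => B.1) Subtype.val_injective.injOn (by simp)
    (fun B _ hB => ?_) (fun _ _ => rfl)
  by_cases h : B.card = r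
  · rw [det_edgeMatrix_of_card_eq M B h]
    by_contra h0
    exact hB ⟨⟨B, h, fun h' => h0 (by simp [h'])⟩, Finset.mem_coe.mpr (Finset.mem_univ _), rfl⟩
  · exact det_edgeMatrix_of_card_ne M B h

/-- A square matrix whose columns span the sandpile lattice. -/
def latticeMatrix (M : Matrix (Fin r) (Fin s) ℤ) : Matrix (Col r s) (Col r s) ℤ :=
  Matrix.fromRows (-stdRep M) (dualRep M)

theorem latticeMatrix_mulVec (M : Matrix (Fin r) (Fin s) ℤ) (q : Col r s → ℤ) :
    latticeMatrix M *ᵥ q = Sum.elim (-(stdRep M *ᵥ q)) (dualRep M *ᵥ q) := by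
  rw [latticeMatrix, Matrix.fromRows_mulVec, Matrix.neg_mulVec]

/-- The first `r` columns of the matrix are the negated columns of Dᵀ, and the last `s` form the
standard basis of the kernel of D. The signs make a lattice vector equal to (-Dq, D̂q), with D̂ the
dual of D, which the disjointness argument exploits. -/
theorem sandpileLattice_eq_range (M : Matrix (Fin r) (Fin s) ℤ) :
    sandpileLattice M = LinearMap.range (latticeMatrix M).mulVecLin := by
  apply le_antisymm
  · refine sup_le ?_ ?_
    · rintro _ ⟨u, rfl⟩
      refine ⟨Sum.elim (-u) 0, ?_⟩
      rw [Matrix.mulVecLin_apply, latticeMatrix_mulVec]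
      ext i
      cases i <;> simp [stdRep, dualRep, Matrix.transpose_fromCols, Matrix.fromCols_mulVec,
        Matrix.neg_mulVec, Matrix.mulVec_neg]
    · intro x hx
      -- A kernel vector is determined by its last `s` coordinates.
      refine ⟨Sum.elim 0 (x ∘ Sum.inr), ?_⟩
      rw [LinearMap.mem_ker, Matrix.mulVecLin_apply, stdRep, Matrix.fromCols_mulVec,
        Matrix.one_mulVec] at hx
      rw [Matrix.mulVecLin_apply, latticeMatrix_mulVec]
      ext i
      cases i with
      | inl i =>
        have := congrFun hx i
        simp at this
        simp [stdRep, Matrix.fromCols_mulVec]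
        linarith
      | inr i => simp [dualRep, Matrix.fromCols_mulVec]
  · rintro _ ⟨q, rfl⟩
    rw [sandpileLattice, Submodule.mem_sup]
    refine ⟨_, ⟨-(q ∘ Sum.inl), rfl⟩, Sum.elim (-(M *ᵥ (q ∘ Sum.inr))) (q ∘ Sum.inr), ?_, ?_⟩
    · simp [stdRep, Matrix.fromCols_mulVec]
    · rw [Matrix.mulVecLin_apply, Matrix.mulVecLin_apply, latticeMatrix_mulVec]
      ext i
      cases i <;> simp [stdRep, dualRep, Matrix.transpose_fromCols, Matrix.fromCols_mulVec,
        Matrix.neg_mulVec, Matrix.mulVec_neg]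
      ring

theorem natAbs_det_latticeMatrix (M : Matrix (Fin r) (Fin s) ℤ) :
    (latticeMatrix M).det.natAbs = ∑ B : Bases M, multiplicity B ^ 2 := by
  have h : latticeMatrix M = Matrix.fromBlocks (-1) (-M) (-Mᵀ) 1 := by
    rw [← Matrix.fromRows_fromCols_eq_fromBlocks, latticeMatrix, stdRep, dualRep]
    ext i k
    cases i <;> cases k <;> simp
  rw [h, Matrix.det_fromBlocks_one₂₂, Matrix.neg_mul, Matrix.mul_neg, neg_neg, ← neg_add',
    Matrix.det_neg,
    Int.natAbs_mul, det_eq_sum_multiplicity_sq]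
  simp only [Int.natAbs_pow, Int.natAbs_neg, Int.natAbs_one, one_pow, one_mul, Int.natAbs_natCast]

theorem det_latticeMatrix_ne_zero (M : Matrix (Fin r) (Fin s) ℤ) : (latticeMatrix M).det ≠ 0 := by
  rw [← Int.natAbs_ne_zero, natAbs_det_latticeMatrix]
  have := det_one_add_mul_transpose_pos M
  rw [det_eq_sum_multiplicity_sq] at this
  exact_mod_cast this.ne'

theorem natCard_sandpileGroup (M : Matrix (Fin r) (Fin s) ℤ) :
    Nat.card (SandpileGroup M) = ∑ B : Bases M, multiplicity B ^ 2 := by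
  rw [← natAbs_det_latticeMatrix, ← natCard_quotient_range_mulVecLin _ (det_latticeMatrix_ne_zero M),
    SandpileGroup, sandpileLattice_eq_range]

instance (M : Matrix (Fin r) (Fin s) ℤ) : Finite (SandpileGroup M) := by
  apply Nat.finite_of_card_ne_zero
  rw [natCard_sandpileGroup, ← natAbs_det_latticeMatrix, Int.natAbs_ne_zero]
  exact det_latticeMatrix_ne_zero M

end Determinants

/-! ### Coordinates and facets of a parallelepiped -/

section Parallelepiped

variable {ι : Type*} [Fintype ι] [DecidableEq ι]

/-- The `k`-th coordinate with respect to the basis formed by the columns of `N`. -/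
noncomputable def coord (N : Matrix ι ι ℝ) (k : ι) : (ι → ℝ) →ₗ[ℝ] ℝ :=
  LinearMap.proj k ∘ₗ N⁻¹.mulVecLin

theorem coord_apply (N : Matrix ι ι ℝ) (k : ι) (x : ι → ℝ) : coord N k x = (N⁻¹ *ᵥ x) k := rfl

theorem coord_mulVec {N : Matrix ι ι ℝ} (hN : IsUnit N.det) (k : ι) (a : ι → ℝ) :
    coord N k (N *ᵥ a) = a k := by
  rw [coord_apply, Matrix.mulVec_mulVec, Matrix.nonsing_inv_mul _ hN, Matrix.one_mulVec]

theorem mulVec_coord {N : Matrix ι ι ℝ} (hN : IsUnit N.det) (x : ι → ℝ) :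
    N *ᵥ (fun k => coord N k x) = x := by
  change N *ᵥ (N⁻¹ *ᵥ x) = x
  rw [Matrix.mulVec_mulVec, Matrix.mul_nonsing_inv _ hN, Matrix.one_mulVec]

theorem eq_sum_coord_smul {N : Matrix ι ι ℝ} (hN : IsUnit N.det) (x : ι → ℝ) :
    x = ∑ j, coord N j x • (N *ᵥ Pi.single j 1) := by
  conv_lhs => rw [← mulVec_coord hN x, Matrix.mulVec_eq_sum]
  refine Finset.sum_congr rfl fun j _ => ?_
  rw [Matrix.mulVec_single_one, op_smul_eq_smul]
  rfl

/-- The parallelepiped spanned by the columns of `N`. -/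
def box (N : Matrix ι ι ℝ) : Set (ι → ℝ) := {x | ∀ k, coord N k x ∈ Set.Icc (0 : ℝ) 1}

theorem zero_mem_box (N : Matrix ι ι ℝ) : (0 : ι → ℝ) ∈ box N := fun k => by simp

theorem column_mem_box {N : Matrix ι ι ℝ} (hN : IsUnit N.det) (j : ι) :
    N *ᵥ Pi.single j 1 ∈ box N := fun k => by
  rw [coord_mulVec hN, Pi.single_apply]
  split_ifs <;> simp

theorem vectorSpan_box {N : Matrix ι ι ℝ} (hN : IsUnit N.det) : vectorSpan ℝ (box N) = ⊤ := by
  rw [eq_top_iff]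
  intro x _
  rw [eq_sum_coord_smul hN x]
  refine Submodule.sum_mem _ fun j _ => Submodule.smul_mem _ _ ?_
  simpa using vsub_mem_vectorSpan ℝ (column_mem_box hN j) (zero_mem_box N)

/-- The face contains the origin and every column except the `k`-th, and these columns span the
kernel. -/
theorem vectorSpan_box_inter_ker {N : Matrix ι ι ℝ} (hN : IsUnit N.det) (k : ι) :
    vectorSpan ℝ (box N ∩ {x | coord N k x = 0}) = LinearMap.ker (coord N k) := by
  apply le_antisymm
  · rw [vectorSpan_def, Submodule.span_le]
    rintro _ ⟨x, hx, y, hy, rfl⟩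
    have h1 : coord N k x = 0 := hx.2
    have h2 : coord N k y = 0 := hy.2
    simp [h1, h2]
  · intro x hx
    rw [eq_sum_coord_smul hN x]
    refine Submodule.sum_mem _ fun j _ => ?_
    by_cases hj : j = k
    · subst hj
      rw [LinearMap.mem_ker.mp hx, zero_smul]
      exact Submodule.zero_mem _
    · refine Submodule.smul_mem _ _ ?_
      have hmem : N *ᵥ Pi.single j 1 ∈ box N ∩ {x | coord N k x = 0} := by
        refine ⟨column_mem_box hN j, ?_⟩
        rw [Set.mem_ofPred_eq, coord_mulVec hN, Pi.single_eq_of_ne (Ne.symm hj)]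
      have hzero : (0 : ι → ℝ) ∈ box N ∩ {x | coord N k x = 0} :=
        ⟨zero_mem_box N, map_zero (coord N k)⟩
      simpa using vsub_mem_vectorSpan ℝ hmem hzero

theorem coord_ne_zero {N : Matrix ι ι ℝ} (hN : IsUnit N.det) (k : ι) : coord N k ≠ 0 := by
  intro h
  have := coord_mulVec hN k (Pi.single k 1)
  simp [h] at this

/-- The functional `-coord N k` is at most zero on the box and attains zero at the origin. -/
theorem isExposed_box_inter_ker (N : Matrix ι ι ℝ) (k : ι) :
    IsExposed ℝ (box N) (box N ∩ {x | coord N k x = 0}) := by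
  intro _
  refine ⟨LinearMap.toContinuousLinearMap (-coord N k), ?_⟩
  ext x
  simp only [Set.mem_inter_iff, Set.mem_ofPred_eq, LinearMap.coe_toContinuousLinearMap',
    LinearMap.neg_apply, neg_le_neg_iff]
  refine and_congr_right fun hx => ⟨fun h y hy => h ▸ (hy k).1, fun h => ?_⟩
  exact le_antisymm (by simpa using h 0 (zero_mem_box N)) (hx k).1

end Parallelepiped

/-! ### The parallelepipeds P(B) and disjointness of their translates -/

section Tile

variable {r s : ℕ}

theorem isFacet_box_inter_ker {N : Matrix (Col r s) (Col r s) ℝ} (hN : IsUnit N.det)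
    (k : Col r s) : IsFacet (box N) (box N ∩ {x | coord N k x = 0}) := by
  refine ⟨⟨0, zero_mem_box N, map_zero (coord N k)⟩, isExposed_box_inter_ker N k, ?_⟩
  rw [vectorSpan_box_inter_ker hN, vectorSpan_box hN, finrank_top]
  exact Module.Dual.finrank_ker_add_one_of_ne_zero (coord_ne_zero hN k)

variable {M : Matrix (Fin r) (Fin s) ℤ}

theorem toReal_edgeMatrix_mulVec (M : Matrix (Fin r) (Fin s) ℤ) (B : Finset (Col r s))
    (a : Col r s → ℝ) :
    toReal (edgeMatrix M B) *ᵥ a =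
      Sum.elim (toReal (stdRep M) *ᵥ fun k => if k ∈ B then a k else 0)
        (toReal (dualRep M) *ᵥ fun k => if k ∈ B then 0 else a k) := by
  ext i
  cases i <;> simp only [Matrix.mulVec, dotProduct, Sum.elim_inl, Sum.elim_inr] <;>
    refine Finset.sum_congr rfl fun k _ => ?_ <;> by_cases hk : k ∈ B <;> simp [edgeMatrix, hk]

theorem mem_P_iff_exists (B : Bases M) (x : Col r s → ℝ) :
    x ∈ P B ↔ ∃ a : Col r s → ℝ, (∀ k, a k ∈ Set.Icc (0 : ℝ) 1) ∧
      x = toReal (edgeMatrix M B.1) *ᵥ a := by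
  have sum₁ (f : Col r s → ℝ) :
      ∑ k, (if k ∈ B.1 then f k else 0) = ∑ k : {k // k ∈ B.1}, f k := by
    rw [Finset.sum_ite_mem, Finset.univ_inter, Finset.sum_coe_sort]
  have sum₂ (f : Col r s → ℝ) :
      ∑ k, (if k ∈ B.1 then 0 else f k) = ∑ k : {k // k ∉ B.1}, f k := by
    rw [← Fintype.sum_subtype_add_sum_subtype (· ∈ B.1)]
    rw [Finset.sum_eq_zero (fun k _ => if_pos k.2), zero_add]
    exact Finset.sum_congr rfl fun k _ => if_neg k.2
  have key (a : Col r s → ℝ) : x = toReal (edgeMatrix M B.1) *ᵥ a ↔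
      (∀ i, x (Sum.inl i) = ∑ k : {k // k ∈ B.1}, a k * (stdRep M i k : ℝ)) ∧
      ∀ j, x (Sum.inr j) = ∑ k : {k // k ∉ B.1}, a k * (dualRep M j k : ℝ) := by
    rw [toReal_edgeMatrix_mulVec, funext_iff, Sum.forall]
    refine and_congr (forall_congr' fun i => ?_) (forall_congr' fun j => ?_)
    · rw [← sum₁ fun k => a k * (stdRep M i k : ℝ)]
      simp [Matrix.mulVec, dotProduct, mul_comm]
    · rw [← sum₂ fun k => a k * (dualRep M j k : ℝ)]
      simp [Matrix.mulVec, dotProduct, mul_comm]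
  constructor
  · rintro ⟨⟨a₁, h₁, h₁'⟩, a₂, h₂, h₂'⟩
    refine ⟨fun k => if h : k ∈ B.1 then a₁ ⟨k, h⟩ else a₂ ⟨k, h⟩, fun k => ?_, ?_⟩
    · by_cases h : k ∈ B.1
      · simpa [h] using h₁ ⟨k, h⟩
      · simpa [h] using h₂ ⟨k, h⟩
    · refine (key _).mpr ⟨fun i => (h₁' i).trans (Finset.sum_congr rfl fun k _ => ?_),
        fun j => (h₂' j).trans (Finset.sum_congr rfl fun k _ => ?_)⟩
      · simp [k.2]
      · simp [k.2]
  · rintro ⟨a, ha, hx⟩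
    obtain ⟨h₁, h₂⟩ := (key a).mp hx
    exact ⟨⟨fun k => a k, fun k => ha k, h₁⟩, fun k => a k, fun k => ha k, h₂⟩

theorem isUnit_det_edgeMatrix (B : Bases M) : IsUnit (toReal (edgeMatrix M B.1)).det :=
  isUnit_det_toReal (det_edgeMatrix_basis_ne_zero B)

theorem P_eq_box (B : Bases M) : P B = box (toReal (edgeMatrix M B.1)) := by
  ext x
  rw [mem_P_iff_exists]
  constructor
  · rintro ⟨a, ha, rfl⟩ k
    rw [coord_mulVec (isUnit_det_edgeMatrix B)]
    exact ha k
  · exact fun hx => ⟨_, hx, (mulVec_coord (isUnit_det_edgeMatrix B) x).symm⟩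

/-- Only the facets through the origin are needed: their directions are the kernels of the
coordinates. -/
theorem IsShiftingVector.coord_ne_zero {w : Col r s → ℝ} (hw : IsShiftingVector M w)
    (B : Bases M) (k : Col r s) : coord (toReal (edgeMatrix M B.1)) k w ≠ 0 := by
  have hN := isUnit_det_edgeMatrix B
  have hF := isFacet_box_inter_ker hN k
  rw [← P_eq_box] at hF
  have h := hw B _ hF
  rw [P_eq_box] at h
  rwa [vectorSpan_box_inter_ker hN] at h

/-- The kernel of the dual matrix is the real row space of D, hence orthogonal to the kernel of D.
-/
theorem dotProduct_eq_zero_of_mulVec_eq_zero {x y : Col r s → ℝ}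
    (hx : toReal (stdRep M) *ᵥ x = 0) (hy : toReal (dualRep M) *ᵥ y = 0) : x ⬝ᵥ y = 0 := by
  have h1 : toReal (stdRep M) = Matrix.fromCols 1 (toReal M) := by
    ext i k; cases k <;> simp [stdRep, Matrix.one_apply]
  have h2 : toReal (dualRep M) = Matrix.fromCols (-(toReal M)ᵀ) 1 := by
    ext i k; cases k <;> simp [dualRep, Matrix.one_apply]
  rw [h1, Matrix.fromCols_mulVec, Matrix.one_mulVec] at hx
  rw [h2, Matrix.fromCols_mulVec, Matrix.one_mulVec, Matrix.neg_mulVec] at hy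
  have hx' : x ∘ Sum.inl = -(toReal M *ᵥ (x ∘ Sum.inr)) := eq_neg_of_add_eq_zero_left hx
  have hy' : y ∘ Sum.inr = (toReal M)ᵀ *ᵥ (y ∘ Sum.inl) := (neg_add_eq_zero.mp hy).symm
  have : x ⬝ᵥ y = (x ∘ Sum.inl) ⬝ᵥ (y ∘ Sum.inl) + (x ∘ Sum.inr) ⬝ᵥ (y ∘ Sum.inr) := by
    simp [dotProduct]
  rw [this, hx', hy', neg_dotProduct, Matrix.mulVec_transpose,
    dotProduct_comm (x ∘ Sum.inr), ← Matrix.dotProduct_mulVec, dotProduct_comm, neg_add_cancel]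

/-- The interiors of distinct lattice translates of the parallelepipeds `P B` are disjoint. -/
theorem eq_of_interior_inter {B B' : Finset (Col r s)} {a a' : Col r s → ℝ} {q : Col r s → ℤ}
    (ha : ∀ k, a k ∈ Set.Ioo (0 : ℝ) 1) (ha' : ∀ k, a' k ∈ Set.Ioo (0 : ℝ) 1)
    (h : toReal (edgeMatrix M B) *ᵥ a - toReal (edgeMatrix M B') *ᵥ a' =
      toReal (latticeMatrix M) *ᵥ fun k => (q k : ℝ)) : B = B' ∧ q = 0 := by
  set b : Col r s → ℝ := fun k => if k ∈ B then a k else 0 with hb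
  set b' : Col r s → ℝ := fun k => if k ∈ B' then a' k else 0 with hb'
  set c : Col r s → ℝ := fun k => if k ∈ B then 0 else a k with hc
  set c' : Col r s → ℝ := fun k => if k ∈ B' then 0 else a' k with hc'
  set Q : Col r s → ℝ := fun k => (q k : ℝ) with hQ
  have hL : toReal (latticeMatrix M) *ᵥ Q =
      Sum.elim (-(toReal (stdRep M) *ᵥ Q)) (toReal (dualRep M) *ᵥ Q) := by
    rw [hQ, toReal_mulVec_intCast, toReal_mulVec_intCast, toReal_mulVec_intCast,
      latticeMatrix_mulVec]
    ext i
    cases i <;> simp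
  rw [toReal_edgeMatrix_mulVec, toReal_edgeMatrix_mulVec, hL] at h
  -- The upper and lower halves of `h` give a vector in the kernel of D and one in the kernel of its
  -- dual.
  have h1 : toReal (stdRep M) *ᵥ (b - b' + Q) = 0 := by
    rw [Matrix.mulVec_add, Matrix.mulVec_sub]
    ext i
    have := congrFun h (Sum.inl i)
    simp only [Pi.sub_apply, Sum.elim_inl, Pi.neg_apply] at this
    simp only [Pi.add_apply, Pi.sub_apply, Pi.zero_apply]
    linarith
  have h2 : toReal (dualRep M) *ᵥ (c - c' - Q) = 0 := by
    rw [Matrix.mulVec_sub, Matrix.mulVec_sub]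
    ext i
    have := congrFun h (Sum.inr i)
    simp only [Pi.sub_apply, Sum.elim_inr] at this
    simp only [Pi.sub_apply, Pi.zero_apply]
    linarith
  have hsum := dotProduct_eq_zero_of_mulVec_eq_zero h1 h2
  have hq (m : ℤ) : m = 0 ∨ (m : ℝ) ≤ -1 ∨ (1 : ℝ) ≤ m := by
    rcases lt_trichotomy m 0 with hm | hm | hm
    · right; left; exact_mod_cast Int.le_sub_one_of_lt hm
    · left; exact hm
    · right; right; exact_mod_cast hm
  -- Their dot product is zero, yet no coordinate contributes positively. Strict inequalities on `a`
  -- and `a'` and integrality of `q` make the two factors have opposite signs, unless `B` and `B'`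
  -- agree at `k` and `q k = 0`.
  have hneg (k : Col r s) (hk : ¬ ((k ∈ B ↔ k ∈ B') ∧ q k = 0)) :
      (b - b' + Q) k * (c - c' - Q) k < 0 := by
    obtain ⟨ha0, ha1⟩ := ha k
    obtain ⟨ha0', ha1'⟩ := ha' k
    by_cases hB : k ∈ B <;> by_cases hB' : k ∈ B' <;>
      rcases hq (q k) with h0 | h0 | h0 <;>
      simp only [hb, hb', hc, hc', hQ, Pi.add_apply, Pi.sub_apply, hB, hB', if_true, if_false]
        at hk ⊢ <;>
      first
      | exact (hk ⟨trivial, h0⟩).elim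
      | (rw [h0, Int.cast_zero]; exact mul_neg_of_pos_of_neg (by linarith) (by linarith))
      | (rw [h0, Int.cast_zero]; exact mul_neg_of_neg_of_pos (by linarith) (by linarith))
      | exact mul_neg_of_pos_of_neg (by linarith) (by linarith)
      | exact mul_neg_of_neg_of_pos (by linarith) (by linarith)
  have hle (k : Col r s) : (b - b' + Q) k * (c - c' - Q) k ≤ 0 := by
    by_cases hk : (k ∈ B ↔ k ∈ B') ∧ q k = 0
    · by_cases hB : k ∈ B
      · have hB' := hk.1.mp hB
        simp [hb, hb', hc, hc', hQ, hB, hB', hk.2]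
      · have hB' : k ∉ B' := fun h => hB (hk.1.mpr h)
        simp [hb, hb', hc, hc', hQ, hB, hB', hk.2]
    · exact (hneg k hk).le
  have hall (k : Col r s) : (k ∈ B ↔ k ∈ B') ∧ q k = 0 := by
    by_contra hk
    exact (Finset.sum_neg' (fun k _ => hle k) ⟨k, Finset.mem_univ k, hneg k hk⟩).ne hsum
  exact ⟨Finset.ext fun k => (hall k).1, funext fun k => (hall k).2⟩

end Tile

/-! ### Associated vectors and the counting argument -/

section Associated

variable {r s : ℕ} {M : Matrix (Fin r) (Fin s) ℤ} {w : Col r s → ℝ}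

theorem pointsInto_iff_eventually {X : Set (Col r s → ℝ)} {z : Col r s → ℤ} :
    PointsInto X w z ↔ ∀ᶠ ε in 𝓝[>] (0 : ℝ), (fun i => (z i : ℝ) + ε * w i) ∈ X := by
  rw [eventually_nhdsWithin_iff, Metric.eventually_nhds_iff]
  refine exists_congr fun ε₀ => and_congr_right fun _ => forall_congr' fun ε => ?_
  rw [Real.dist_eq, sub_zero]
  constructor
  · intro h h1 h2
    exact h h2 (by rwa [abs_of_pos h2] at h1)
  · intro h h1 h2
    exact h (by rwa [abs_of_pos h1]) h1

theorem mem_P_shift_iff (B : Bases M) (z : Col r s → ℤ) (ε : ℝ) :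
    (fun i => (z i : ℝ) + ε * w i) ∈ P B ↔
      ∀ k, coord (toReal (edgeMatrix M B.1)) k (fun i => (z i : ℝ)) +
        ε * coord (toReal (edgeMatrix M B.1)) k w ∈ Set.Icc (0 : ℝ) 1 := by
  rw [P_eq_box]
  have : (fun i => (z i : ℝ) + ε * w i) = (fun i => (z i : ℝ)) + ε • w := rfl
  rw [this]
  refine forall_congr' fun k => ?_
  rw [map_add, map_smul, smul_eq_mul]

/-- The half-open parallelepiped condition on the coordinates of `z`. -/
def InHalfOpen (w : Col r s → ℝ) (z : Col r s → ℤ) (B : Bases M) : Prop :=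
  ∀ k, HalfOpen (coord (toReal (edgeMatrix M B.1)) k w)
    (coord (toReal (edgeMatrix M B.1)) k (fun i => (z i : ℝ)))

theorem inHalfOpen_of_frequently (hw : IsShiftingVector M w) {z : Col r s → ℤ} {B : Bases M}
    (h : ∃ᶠ ε in 𝓝[>] (0 : ℝ), (fun i => (z i : ℝ) + ε * w i) ∈ P B) : InHalfOpen w z B :=
  fun k => halfOpen_of_frequently (hw.coord_ne_zero B k)
    (h.mono fun ε hε => (mem_P_shift_iff B z ε).mp hε k)

theorem InHalfOpen.eventually (hw : IsShiftingVector M w) {z : Col r s → ℤ} {B : Bases M}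
    (h : InHalfOpen w z B) : ∀ᶠ ε in 𝓝[>] (0 : ℝ),
      ∀ k, coord (toReal (edgeMatrix M B.1)) k (fun i => (z i : ℝ) + ε * w i) ∈
        Set.Ioo (0 : ℝ) 1 := by
  rw [eventually_all]
  intro k
  filter_upwards [(h k).eventually_mem_Ioo (hw.coord_ne_zero B k)] with ε hε
  have : (fun i => (z i : ℝ) + ε * w i) = (fun i => (z i : ℝ)) + ε • w := rfl
  rwa [this, map_add, map_smul, smul_eq_mul]

theorem isAssociated_iff (hw : IsShiftingVector M w) {z : Col r s → ℤ} {B : Bases M} :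
    IsAssociated w z B ↔ InHalfOpen w z B := by
  rw [IsAssociated, pointsInto_iff_eventually]
  refine ⟨fun h => inHalfOpen_of_frequently hw h.frequently, fun h => ?_⟩
  filter_upwards [h.eventually hw] with ε hε
  rw [P_eq_box]
  exact fun k => Set.Ioo_subset_Icc_self (hε k)

theorem isRepresentative_iff (hw : IsShiftingVector M w) {z : Col r s → ℤ} :
    IsRepresentative M w z ↔ ∃ B : Bases M, IsAssociated w z B := by
  constructor
  · intro h
    rw [IsRepresentative, pointsInto_iff_eventually] at h
    by_contra! hne
    have h' : ∀ B : Bases M, ∀ᶠ ε in 𝓝[>] (0 : ℝ), (fun i => (z i : ℝ) + ε * w i) ∉ P B := by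
      intro B
      rw [← not_frequently]
      exact fun hf => hne B ((isAssociated_iff hw).mpr (inHalfOpen_of_frequently hw hf))
    obtain ⟨ε, h1, h2⟩ := (h.and (eventually_all.mpr h')).exists
    obtain ⟨B, hB⟩ := Set.mem_iUnion.mp h1
    exact h2 B hB
  · rintro ⟨B, ε₀, h0, h⟩
    exact ⟨ε₀, h0, fun ε h1 h2 => Set.mem_iUnion.mpr ⟨B, h ε h1 h2⟩⟩

/-- Two associated pairs in the same sandpile class coincide. -/
theorem eq_of_isAssociated (hw : IsShiftingVector M w) {z z' : Col r s → ℤ} {B B' : Bases M}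
    (h : IsAssociated w z B) (h' : IsAssociated w z' B')
    (hzz : (Submodule.Quotient.mk z : SandpileGroup M) = Submodule.Quotient.mk z') :
    B = B' ∧ z = z' := by
  rw [isAssociated_iff hw] at h h'
  obtain ⟨ε, h1, h2⟩ := ((h.eventually hw).and (h'.eventually hw)).exists
  have hmem := (Submodule.Quotient.eq _).mp hzz
  rw [sandpileLattice_eq_range] at hmem
  obtain ⟨q, hq⟩ := hmem
  rw [Matrix.mulVecLin_apply] at hq
  -- Both points are shifted by the same `ε • w`, so their difference is the lattice vector `z -
  -- z'`.
  have key := eq_of_interior_inter (M := M) (q := q) h1 h2 (by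
    rw [mulVec_coord (isUnit_det_edgeMatrix B), mulVec_coord (isUnit_det_edgeMatrix B'),
      toReal_mulVec_intCast, hq]
    ext i
    simp)
  refine ⟨Subtype.ext key.1, ?_⟩
  rw [key.2, Matrix.mulVec_zero] at hq
  exact (sub_eq_zero.mp hq.symm)

theorem natCard_isAssociated (hw : IsShiftingVector M w) (B : Bases M) :
    Nat.card {z : Col r s → ℤ // IsAssociated w z B} = multiplicity B ^ 2 := by
  simp_rw [isAssociated_iff hw]
  refine (natCard_halfOpen (det_edgeMatrix_basis_ne_zero B) _).trans ?_
  rw [det_edgeMatrix_basis, Int.natAbs_pow, Int.natAbs_natCast]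

theorem multiplicity_pos (B : Bases M) : 0 < multiplicity B := Int.natAbs_pos.mpr B.2.snd

/-- An injection between finite sets of equal size is onto, so every class has a representative
although no tiling of space was proved. -/
theorem bijective_class_of_associated (hw : IsShiftingVector M w) :
    Function.Bijective (fun p : (B : Bases M) × {z : Col r s → ℤ // IsAssociated w z B} =>
      (Submodule.Quotient.mk p.2.1 : SandpileGroup M)) := by
  have hfin (B : Bases M) : Finite {z : Col r s → ℤ // IsAssociated w z B} :=
    Nat.finite_of_card_ne_zero <| by
      rw [natCard_isAssociated hw]
      exact pow_ne_zero 2 (multiplicity_pos B).ne'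
  refine Function.Injective.bijective_of_nat_card_le ?_ ?_
  · rintro ⟨B, z, hz⟩ ⟨B', z', hz'⟩ h
    obtain ⟨rfl, rfl⟩ := eq_of_isAssociated hw hz hz' h
    rfl
  · rw [Nat.card_sigma, natCard_sandpileGroup]
    simp_rw [natCard_isAssociated hw]
    exact le_rfl

end Associated

end SandpileMultijection

/-! ### The map and its fibres -/

open SandpileMultijection in
theorem mainTheorem1 (r s : ℕ) (M : Matrix (Fin r) (Fin s) ℤ)
    (w : SandpileMultijection.Col r s → ℝ)
    (hw : SandpileMultijection.IsShiftingVector M w) :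
    -- every sandpile class contains exactly one `w`-representative
    (∀ c : SandpileMultijection.SandpileGroup M,
      ∃! z : SandpileMultijection.Col r s → ℤ,
        Submodule.Quotient.mk z = c ∧ SandpileMultijection.IsRepresentative M w z) ∧
    -- every `w`-representative is `w`-associated with exactly one basis
    (∀ z : SandpileMultijection.Col r s → ℤ, SandpileMultijection.IsRepresentative M w z →
      ∃! B : SandpileMultijection.Bases M, SandpileMultijection.IsAssociated w z B) ∧
    -- hence the rule defines exactly one map `f_w`, and this map is a multijection
    (∃ f : SandpileMultijection.SandpileGroup M → SandpileMultijection.Bases M,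
      SandpileMultijection.FollowsRule w f ∧
      (∀ g : SandpileMultijection.SandpileGroup M → SandpileMultijection.Bases M,
        SandpileMultijection.FollowsRule w g → g = f) ∧
      SandpileMultijection.IsMultijection
        (fun B => SandpileMultijection.multiplicity B ^ 2) f) := by
  have hex (c : SandpileGroup M) : ∃ (B : Bases M) (z : Col r s → ℤ),
      IsAssociated w z B ∧ Submodule.Quotient.mk z = c := by
    obtain ⟨⟨B, z, hz⟩, h⟩ := (bijective_class_of_associated hw).surjective c
    exact ⟨B, z, hz, h⟩
  choose f rep hrep hmk using hex
  -- Any map obeying the rule is pinned down on the chosen representatives, which gives uniqueness.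
  have hrule (g : SandpileGroup M → Bases M) (hg : FollowsRule w g) (c : SandpileGroup M) :
      IsAssociated w (rep c) (g c) := by
    have := hg (rep c) ((isRepresentative_iff hw).mpr ⟨_, hrep c⟩)
    rwa [hmk] at this
  refine ⟨fun c => ?_, fun z hz => ?_, f, fun z hz => ?_, fun g hg => funext fun c => ?_,
    fun B => ?_⟩
  · refine ⟨rep c, ⟨hmk c, (isRepresentative_iff hw).mpr ⟨_, hrep c⟩⟩, fun z' ⟨h1, h2⟩ => ?_⟩
    obtain ⟨B', hB'⟩ := (isRepresentative_iff hw).mp h2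
    exact (eq_of_isAssociated hw hB' (hrep c) (h1.trans (hmk c).symm)).2
  · obtain ⟨B, hB⟩ := (isRepresentative_iff hw).mp hz
    exact ⟨B, hB, fun B' hB' => (eq_of_isAssociated hw hB' hB rfl).1⟩
  · obtain ⟨B, hB⟩ := (isRepresentative_iff hw).mp hz
    obtain ⟨h1, -⟩ := eq_of_isAssociated hw hB (hrep (Submodule.Quotient.mk z)) (hmk _).symm
    exact h1 ▸ hB
  · exact (eq_of_isAssociated hw (hrule g hg c) (hrep c) rfl).1
  -- The fibre is the injective image of the vectors associated with `B`, which are already counted.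
  · have himage : f ⁻¹' {B} = (fun z => (Submodule.Quotient.mk z : SandpileGroup M)) ''
        {z | IsAssociated w z B} := by
      ext c
      constructor
      · rintro rfl
        exact ⟨rep c, hrep c, hmk c⟩
      · rintro ⟨z, hz, rfl⟩
        exact (eq_of_isAssociated hw hz (hrep _) (hmk _).symm).1.symm
    have hfin : Finite {z : Col r s → ℤ | IsAssociated w z B} :=
      Nat.finite_of_card_ne_zero <| by
        rw [Set.coe_ofPred, natCard_isAssociated hw]
        exact pow_ne_zero 2 (multiplicity_pos B).ne'
    have hinj : Set.InjOn (fun z => (Submodule.Quotient.mk z : SandpileGroup M))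
        {z | IsAssociated w z B} := fun z hz z' hz' h => (eq_of_isAssociated hw hz hz' h).2
    rw [himage, hinj.encard_image,
      ← Set.Finite.cast_ncard_eq (Set.toFinite _), ← Nat.card_coe_set_eq, Set.coe_ofPred,
      natCard_isAssociated hw]
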